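/- Let $d\ge 1$ and let $X$ be an integrable random vector in $\mathbb{R}^d$ with mean $\mu=\mathbb{E}[X]$ and an elliptical density with positive definite scatter matrix $\Sigma\in\mathbb{R}^{d\times d}$, that is, a density of the form \[ x\longmapsto C\,\det(\Sigma)^{-1/2}\,g\bigl((x-\mu)^T\Sigma^{-1}(x-\mu)\bigr), \] where $g:[0,\infty)\to[0,\infty)$ is measurable with $\int_0^\infty s^{d/2-1}g(s)\,ds<\infty$ and $C>0$ is the normalization constant. Assume that for every unit vector $u\in\mathbb{R}^d$ the projection $\langle X-\mu,u\rangle$ has a density $\varphi_u$ on $\mathbb{R}$ that is log-concave ($\log\varphi_u$ is concave, where $\log 0=-\infty$ is allowed) and weakly symmetric (its mean is also a median). For a unit vector $u$ and $t\in\mathbb{R}$ put $A_{u,t}=\{x\in\mathbb{R}^d:\langle x-\mu,u\rangle\le t\}$ and \[ F(u,t)=\frac{\bigl\|\mathbb{E}[X\mathbf 1_{A_{u,t}}(X)]\bigr\|^2}{\mathbb{P}(X\in A_{u,t})}+\frac{\bigl\|\mathbb{E}[X\mathbf 1_{A_{u,t}^c}(X)]\bigr\|^2}{\mathbb{P}(X\in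 A_{u,t}^c)}, \] where a term whose event has probability $0$ is read as $0$. Then: (i) For every unit vector $u$, the map $t\mapsto F(u,t)$ attains its maximum over $\mathbb{R}$ at $t=0$. (ii) Let $\lambda_{\max}(\Sigma)$ be the largest eigenvalue of $\Sigma$. A unit vector $u$ maximizes $v\mapsto F(v,0)$ over all unit vectors $v$ if and only if $u$ is an eigenvector of $\Sigma$ for the eigenvalue $\lambda_{\max}(\Sigma)$. -/

import Mathlib

open MeasureTheory Set Module

noncomputable section

/-- A nonnegative function `φ` on `ℝ` is log-concave if `log φ` is concave, with the usual
convention `log 0 = -∞`: the set where `φ` is positive is convex and `log φ` is concave on it. -/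
def IsLogConcave (φ : ℝ → ℝ) : Prop :=
  (∀ x, 0 ≤ φ x) ∧ ConcaveOn ℝ {x | 0 < φ x} (fun x => Real.log (φ x))

/-- `φ` is a density of the measure `ν` with respect to Lebesgue measure on `ℝ`. -/
def IsDensityOf (φ : ℝ → ℝ) (ν : Measure ℝ) : Prop :=
  Measurable φ ∧ (∀ x, 0 ≤ φ x) ∧ ν = volume.withDensity (fun x => ENNReal.ofReal (φ x))

/-- A density on `ℝ` is weakly symmetric if its mean exists and is also a median. -/
def IsWeaklySymmetric (φ : ℝ → ℝ) : Prop :=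
  Integrable (fun x => x * φ x) ∧ ∫ x in Iic (∫ y, y * φ y), φ x = 1 / 2

/-- The law `ν` on `ℝ` has a weakly symmetric log-concave density. -/
def HasWeaklySymmetricLogConcaveDensity (ν : Measure ℝ) : Prop :=
  ∃ φ : ℝ → ℝ, IsDensityOf φ ν ∧ IsLogConcave φ ∧ IsWeaklySymmetric φ

/-- The law `ν` on `ℝ^d` has the elliptical density
`x ↦ C * det(S)^(-1/2) * g ((x - m)ᵀ S⁻¹ (x - m))`
with location `m`, scatter matrix `S`, density generator `g : [0, ∞) → [0, ∞)`
(only the values of `g` on `[0, ∞)` matter) and normalization constant `C`. -/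
def HasEllipticalDensity {d : ℕ} (ν : Measure (EuclideanSpace ℝ (Fin d)))
    (m : EuclideanSpace ℝ (Fin d)) (S : Matrix (Fin d) (Fin d) ℝ) : Prop :=
  ∃ (g : ℝ → ℝ) (C : ℝ), Measurable g ∧ (∀ s, 0 ≤ s → 0 ≤ g s) ∧
    IntegrableOn (fun s : ℝ => s ^ ((d : ℝ) / 2 - 1) * g s) (Ioi 0) ∧ 0 < C ∧
    ν = volume.withDensity (fun x : EuclideanSpace ℝ (Fin d) =>
      ENNReal.ofReal (C * S.det ^ (-(1 / 2) : ℝ) *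
        g ((x - m).ofLp ⬝ᵥ (S⁻¹.mulVec (x - m).ofLp))))

/-- The halfspace `{x | ⟨x - m, u⟩ ≤ t}`. -/
def halfspace {d : ℕ} (m u : EuclideanSpace ℝ (Fin d)) (t : ℝ) :
    Set (EuclideanSpace ℝ (Fin d)) :=
  {x | inner ℝ (x - m) u ≤ t}

/-- The two-regime objective
`‖E[X 1_A(X)]‖² / P(X ∈ A) + ‖E[X 1_{Aᶜ}(X)]‖² / P(X ∈ Aᶜ)` of a set `A`.
A term whose event has probability zero is `0 / 0 = 0`. -/
def regimeObjective {Ω : Type*} [MeasurableSpace Ω] {d : ℕ} (P : Measure Ω)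
    (X : Ω → EuclideanSpace ℝ (Fin d)) (A : Set (EuclideanSpace ℝ (Fin d))) : ℝ :=
  ‖∫ ω in X ⁻¹' A, X ω ∂P‖ ^ 2 / P.real (X ⁻¹' A) +
    ‖∫ ω in X ⁻¹' Aᶜ, X ω ∂P‖ ^ 2 / P.real (X ⁻¹' Aᶜ)

/-- The halfspace functional `F(u, t)`, with halfspaces centered at the mean of `X`. -/
def halfspaceFunctional {Ω : Type*} [MeasurableSpace Ω] {d : ℕ} (P : Measure Ω)
    (X : Ω → EuclideanSpace ℝ (Fin d)) (u : EuclideanSpace ℝ (Fin d)) (t : ℝ) : ℝ :=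
  regimeObjective P X (halfspace (∫ ω, X ω ∂P) u t)

end

/-! Put L = Σ, Z = ⟨X - μ, u⟩, q(t) = P(Z > t) and H(t) = E[Z; Z > t]. The centred partial means
over a set and its complement are opposite, so F(u,t) = ‖μ‖² + ‖w‖² / (q(1 - q)) with w = E[X - μ;
A] (`regimeObjective_eq`). The centred law is invariant under every `scatterReflection`, which
forces w = -(H(t)/⟨u, Lu⟩) Lu (`setIntegral_halfspace_eq`). Hence t enters only through H²/(q(1 -
q)).

For (i) it remains to show H(t)² ≤ 4q(1 - q)H(0)² for t ≥ 0; negative t follow by exchanging the two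
halfspaces. Here H(t) = t q(t) + ∫_t^∞ q, and 2q is log-concave on [0, ∞) with value 1 at the median
0. Comparison with the exponential that agrees with 2q at 0 and t reduces the claim to (1 + s)² + 1
≤ 2eˢ.

For (ii) the same reflections give (E|Z|)² = κ⟨u, Lu⟩ with κ independent of u. As H(0) = E|Z|/2 and
q(0) = 1/2, F(u,0) = ‖μ‖² + κ‖Lu‖²/⟨u, Lu⟩, and the spectral decomposition of L identifies the
maximizers. -/

/-! ### The extremal inequality on the half-line -/

theorem one_add_sq_add_one_le_two_mul_exp {s : ℝ} (hs : 0 ≤ s) :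
    (1 + s) ^ 2 + 1 ≤ 2 * Real.exp s := by
  nlinarith [Real.quadratic_le_exp_of_nonneg hs]

/-- A normalized antitone function on `[0, ∞)` whose logarithm lies above its chords from `0`
satisfies the extremal inequality for which `x ↦ exp (-x)` is critical. -/
theorem sq_mul_add_integral_Ioi_le {f : ℝ → ℝ} (hf0 : f 0 = 1) (hfn : ∀ x, 0 ≤ f x)
    (hfa : Antitone f) (hfi : IntegrableOn f (Ioi 0))
    (hlc : ∀ x y, 0 ≤ x → x ≤ y → 0 < y → f y ^ (x / y) ≤ f x) {t : ℝ} (ht : 0 ≤ t) :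
    (t * f t + ∫ x in Ioi t, f x) ^ 2 ≤ f t * (2 - f t) * (∫ x in Ioi 0, f x) ^ 2 := by
  have hsplit : ∫ x in Ioi 0, f x = (∫ x in Ioc 0 t, f x) + ∫ x in Ioi t, f x := by
    rw [← setIntegral_union (Ioc_disjoint_Ioi le_rfl) measurableSet_Ioi
      (hfi.mono_set Ioc_subset_Ioi_self) (hfi.mono_set (Ioi_subset_Ioi ht)),
      Ioc_union_Ioi_eq_Ioi ht]
  set A := ∫ x in Ioc 0 t, f x with hA
  set B := ∫ x in Ioi t, f x with hB
  have hft1 : f t ≤ 1 := hf0 ▸ hfa ht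
  have hB0 : 0 ≤ B := integral_nonneg hfn
  rw [hsplit]
  rcases eq_or_lt_of_le ht with rfl | htpos
  · simp [hA, hf0]; norm_num
  rcases eq_or_lt_of_le (hfn t) with h0 | hpos
  · have hBz : B = 0 := by
      rw [hB, setIntegral_congr_fun (g := fun _ => (0 : ℝ)) measurableSet_Ioi, integral_zero]
      intro x hx
      exact le_antisymm (h0 ▸ hfa (le_of_lt hx)) (hfn x)
    rw [← h0, hBz]; simp
  rcases eq_or_lt_of_le hft1 with h1 | hlt
  · have hAt : A = t := by
      rw [hA, setIntegral_congr_fun (g := fun _ => (1 : ℝ)) measurableSet_Ioc]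
      · simp [ht]
      · intro x hx
        exact le_antisymm (hf0 ▸ hfa hx.1.le) (h1 ▸ hfa hx.2)
    rw [h1, hAt]; apply le_of_eq; ring
  -- The rate at which exp (-k x) agrees with `f` at 0 and at `t`. By the chord hypothesis `f` lies
  -- above this exponential on (0, t] and below it beyond `t`.
  set k := -Real.log (f t) / t with hk
  have hkpos : 0 < k := div_pos (neg_pos.2 (Real.log_neg hpos hlt)) htpos
  have hkt : k * t = -Real.log (f t) := by rw [hk]; field_simp
  have hexp : Real.exp (-(k * t)) = f t := by rw [hkt, neg_neg, Real.exp_log hpos]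
  have hint : ∀ c, IntegrableOn (fun x => Real.exp (-k * x)) (Ioi c) :=
    fun c => integrableOn_exp_mul_Ioi (by linarith) c
  have hBle : k * B ≤ f t := by
    have h : B ≤ ∫ x in Ioi t, Real.exp (-k * x) := by
      apply setIntegral_mono_on (hfi.mono_set (Ioi_subset_Ioi ht)) (hint t) measurableSet_Ioi
      intro x hx
      have hx : t < x := hx
      have hx0 : 0 < x := htpos.trans hx
      rcases eq_or_lt_of_le (hfn x) with h0 | hfx
      · rw [← h0]; positivity
      have h := Real.log_le_log (by positivity) (hlc t x ht hx.le hx0)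
      rw [Real.log_rpow hfx, div_mul_eq_mul_div, div_le_iff₀ hx0] at h
      rw [← Real.log_le_iff_le_exp hfx]
      have : t * Real.log (f x) ≤ t * (-k * x) := by
        have : Real.log (f t) = -(k * t) := by linarith
        rw [this] at h; linarith
      exact le_of_mul_le_mul_left this htpos
    rw [integral_exp_mul_Ioi (by linarith), show -k * t = -(k * t) by ring, hexp] at h
    rw [neg_div_neg_eq, le_div_iff₀ hkpos] at h
    linarith
  have hAle : 1 - f t ≤ k * A := by
    have h : ∫ x in Ioc 0 t, Real.exp (-k * x) ≤ A := by
      apply setIntegral_mono_on ((hint 0).mono_set Ioc_subset_Ioi_self)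
        (hfi.mono_set Ioc_subset_Ioi_self) measurableSet_Ioc
      intro x hx
      refine le_trans (le_of_eq ?_) (hlc x t hx.1.le hx.2 htpos)
      rw [Real.rpow_def_of_pos hpos]
      congr 1
      rw [hk]; field_simp
    have h2 : ∫ x in Ioc 0 t, Real.exp (-k * x) = (1 - f t) / k := by
      have h3 := setIntegral_union (μ := volume) (f := fun x => Real.exp (-k * x))
        (Ioc_disjoint_Ioi (a := (0 : ℝ)) (b := t) le_rfl) measurableSet_Ioi
        ((hint 0).mono_set Ioc_subset_Ioi_self) (hint t)
      rw [Ioc_union_Ioi_eq_Ioi ht, integral_exp_mul_Ioi (by linarith),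
        integral_exp_mul_Ioi (by linarith), show -k * t = -(k * t) by ring, hexp] at h3
      simp only [mul_zero, Real.exp_zero] at h3
      rw [neg_div_neg_eq, neg_div_neg_eq] at h3
      rw [sub_div]; linarith
    rw [h2, div_le_iff₀ hkpos] at h
    linarith
  set c := Real.sqrt (f t * (2 - f t)) with hc
  have hcsq : c ^ 2 = f t * (2 - f t) := Real.sq_sqrt (mul_nonneg hpos.le (by linarith))
  have hc0 : 0 ≤ c := Real.sqrt_nonneg _
  have hc1 : c ≤ 1 := by
    rw [hc, Real.sqrt_le_iff]; constructor <;> nlinarith [sq_nonneg (1 - f t)]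
  -- The exponential inequality at s = k t, multiplied by (f t)², since exp (k t) * f t = 1.
  have hkey : (1 + k * t) * f t ≤ c := by
    apply Real.le_sqrt_of_sq_le
    have h := one_add_sq_add_one_le_two_mul_exp (s := k * t) (by positivity)
    have he : Real.exp (k * t) * f t = 1 := by rw [← hexp, ← Real.exp_add]; simp
    have := mul_le_mul_of_nonneg_right h (sq_nonneg (f t))
    nlinarith
  -- After moving c k B to the left, B has coefficient 1 - c ≥ 0 and A has c ≥ 0, so the upper bound
  -- on B and the lower bound on A reduce the claim to `hkey`.
  have hfin : k * (t * f t + B) ≤ k * (c * (A + B)) := by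
    nlinarith [mul_le_mul_of_nonneg_left hBle (sub_nonneg.2 hc1),
      mul_le_mul_of_nonneg_left hAle hc0]
  have hfin := le_of_mul_le_mul_left hfin hkpos
  calc (t * f t + B) ^ 2 ≤ (c * (A + B)) ^ 2 :=
        pow_le_pow_left₀ (by positivity) hfin 2
    _ = _ := by rw [mul_pow, hcsq]

/-! ### Log-concave densities and their tails -/

/-- The points y and x + s are convex combinations of x and y + s with exchanged weights; the two
concavity inequalities add up to the claim. -/
theorem IsLogConcave.mul_le_mul {φ : ℝ → ℝ} (h : IsLogConcave φ) {x y s : ℝ} (hxy : x ≤ y)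
    (hs : 0 ≤ s) : φ x * φ (y + s) ≤ φ y * φ (x + s) := by
  rcases eq_or_lt_of_le (h.1 x) with h0 | hx
  · rw [← h0, zero_mul]; exact mul_nonneg (h.1 _) (h.1 _)
  rcases eq_or_lt_of_le (h.1 (y + s)) with h0 | hy
  · rw [← h0, mul_zero]; exact mul_nonneg (h.1 _) (h.1 _)
  rcases eq_or_lt_of_le (show 0 ≤ (y - x) + s by linarith) with h0 | hd
  · have h1 : y = x := by linarith
    have h2 : s = 0 := by linarith
    subst h1; subst h2; simp
  have ha : 0 ≤ (y - x) / ((y - x) + s) := div_nonneg (by linarith) hd.le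
  have hb : 0 ≤ s / ((y - x) + s) := div_nonneg hs hd.le
  have hab : s / ((y - x) + s) + (y - x) / ((y - x) + s) = 1 := by field_simp; ring
  have e1 : (s / ((y - x) + s)) • x + ((y - x) / ((y - x) + s)) • (y + s) = y := by
    simp only [smul_eq_mul]; field_simp; ring
  have e2 : ((y - x) / ((y - x) + s)) • x + (s / ((y - x) + s)) • (y + s) = x + s := by
    simp only [smul_eq_mul]; field_simp; ring
  have m1 := h.2.1 hx hy hb ha hab
  have m2 := h.2.1 hx hy ha hb (by rw [add_comm]; exact hab)
  have c1 := h.2.2 hx hy hb ha hab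
  have c2 := h.2.2 hx hy ha hb (by rw [add_comm]; exact hab)
  rw [e1] at m1 c1
  rw [e2] at m2 c2
  have m1 : 0 < φ y := m1
  have m2 : 0 < φ (x + s) := m2
  rw [← Real.log_le_log_iff (mul_pos hx hy) (mul_pos m1 m2), Real.log_mul hx.ne' hy.ne',
    Real.log_mul m1.ne' m2.ne']
  simp only [smul_eq_mul] at c1 c2
  have e3 := congrArg (· * (Real.log (φ x) + Real.log (φ (y + s)))) hab
  simp only [one_mul] at e3
  nlinarith

theorem integral_Ioi_eq_integral_Ioi_zero_add (φ : ℝ → ℝ) (x : ℝ) :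
    ∫ y in Ioi x, φ y = ∫ s in Ioi 0, φ (x + s) := by
  have := (measurePreserving_add_left volume x).setIntegral_preimage_emb
    (measurableEmbedding_addLeft x) φ (Ioi x)
  rw [← this]
  congr 2
  ext s; simp

/-- The hazard rate of a log-concave density is monotone. -/
theorem IsLogConcave.mul_integral_Ioi_le {φ : ℝ → ℝ} (h : IsLogConcave φ) (hi : Integrable φ)
    {x y : ℝ} (hxy : x ≤ y) :
    φ x * ∫ z in Ioi y, φ z ≤ φ y * ∫ z in Ioi x, φ z := by
  rw [integral_Ioi_eq_integral_Ioi_zero_add, integral_Ioi_eq_integral_Ioi_zero_add φ x,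
    ← integral_const_mul, ← integral_const_mul]
  apply setIntegral_mono_on _ _ measurableSet_Ioi
  · intro s hs
    exact h.mul_le_mul hxy (le_of_lt hs)
  · exact ((hi.comp_add_left y).const_mul _).integrableOn
  · exact ((hi.comp_add_left x).const_mul _).integrableOn

theorem integral_Ioi_sub_integral_Ioi {φ : ℝ → ℝ} (hi : Integrable φ) (a x : ℝ) :
    ∫ z in Ioi x, φ z = (∫ z in Ioi a, φ z) - ∫ z in a..x, φ z := by
  have := intervalIntegral.integral_interval_add_Ioi (a := a) (b := x) hi.integrableOn
    hi.integrableOn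
  linarith

/-- The tail of a log-concave density is log-concave at points of the interior of the support. -/
theorem IsLogConcave.concaveOn_log_integral_Ioi {φ : ℝ → ℝ} (h : IsLogConcave φ)
    (hi : Integrable φ) {a b c d : ℝ} (hab : a < b) (hcd : c < d) (ha : 0 < φ a)
    (hd : 0 < φ d) (hc : ∀ x, x ≤ c → 0 < ∫ z in Ioi x, φ z) :
    ConcaveOn ℝ (Icc b c) (fun x => Real.log (∫ z in Ioi x, φ z)) := by
  -- The points `a` and `d` put [b, c] inside an open interval of positivity, where concavity makes
  -- φ continuous and the tail differentiable.
  have hsub : ∀ x ∈ Ioo a d, 0 < φ x := fun x hx =>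
    h.2.1.ordConnected.out ha hd ⟨hx.1.le, hx.2.le⟩
  have hcont : ContinuousOn φ (Ioo a d) := by
    have h1 : ContinuousOn (fun x => Real.log (φ x)) (Ioo a d) :=
      (h.2.subset (fun x hx => hsub x hx) (convex_Ioo a d)).continuousOn isOpen_Ioo
    refine (Real.continuous_exp.comp_continuousOn h1).congr fun x hx => ?_
    simp [Real.exp_log (hsub x hx)]
  have hder : ∀ x ∈ Icc b c, HasDerivAt (fun x => Real.log (∫ z in Ioi x, φ z))
      (-φ x / ∫ z in Ioi x, φ z) x := by
    intro x hx
    have hxm : x ∈ Ioo a d := ⟨hab.trans_le hx.1, hx.2.trans_lt hcd⟩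
    have h1 : HasDerivAt (fun x => ∫ z in a..x, φ z) (φ x) x :=
      intervalIntegral.integral_hasDerivAt_right hi.intervalIntegrable
        (hcont.stronglyMeasurableAtFilter isOpen_Ioo x hxm)
        (hcont.continuousAt (isOpen_Ioo.mem_nhds hxm))
    have h2 : HasDerivAt (fun x => ∫ z in Ioi x, φ z) (-φ x) x := by
      have := h1.const_sub (∫ z in Ioi a, φ z)
      refine this.congr_of_eventuallyEq (Filter.Eventually.of_forall fun y => ?_)
      exact integral_Ioi_sub_integral_Ioi hi a y
    exact h2.log (hc x hx.2).ne'
  -- The derivative is minus the hazard rate.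
  apply AntitoneOn.concaveOn_of_deriv (convex_Icc b c)
  · exact fun x hx => (hder x hx).continuousAt.continuousWithinAt
  · rw [interior_Icc]
    exact fun x hx => (hder x (Ioo_subset_Icc_self hx)).differentiableAt.differentiableWithinAt
  · rw [interior_Icc]
    intro x hx y hy hxy
    rw [(hder x (Ioo_subset_Icc_self hx)).deriv, (hder y (Ioo_subset_Icc_self hy)).deriv,
      div_le_div_iff₀ (hc y hy.2.le) (hc x hx.2.le)]
    have := h.mul_integral_Ioi_le hi hxy
    linarith

theorem IsDensityOf.integrable {φ : ℝ → ℝ} {ν : Measure ℝ} [IsFiniteMeasure ν]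
    (h : IsDensityOf φ ν) : Integrable φ := by
  refine ⟨h.1.aestronglyMeasurable, ?_⟩
  rw [hasFiniteIntegral_iff_ofReal (Filter.Eventually.of_forall h.2.1)]
  have := measure_lt_top ν univ
  rw [h.2.2, withDensity_apply _ MeasurableSet.univ, Measure.restrict_univ] at this
  exact this

theorem IsDensityOf.real_eq_setIntegral {φ : ℝ → ℝ} {ν : Measure ℝ} [IsFiniteMeasure ν]
    (h : IsDensityOf φ ν) {s : Set ℝ} (hs : MeasurableSet s) : ν.real s = ∫ x in s, φ x := by
  rw [integral_eq_lintegral_of_nonneg_ae (Filter.Eventually.of_forall h.2.1)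
    h.1.aestronglyMeasurable, Measure.real]
  congr 1
  conv_lhs => rw [h.2.2]
  rw [withDensity_apply _ hs]

theorem IsDensityOf.integral_id_eq {φ : ℝ → ℝ} {ν : Measure ℝ}
    (h : IsDensityOf φ ν) : ∫ x, x ∂ν = ∫ x, x * φ x := by
  rw [h.2.2, integral_withDensity_eq_integral_toReal_smul h.1.ennreal_ofReal
    (Filter.Eventually.of_forall fun x => ENNReal.ofReal_lt_top)]
  refine integral_congr_ae (Filter.Eventually.of_forall fun x => ?_)
  simp [ENNReal.toReal_ofReal (h.2.1 x), mul_comm]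

theorem IsDensityOf.absolutelyContinuous {φ : ℝ → ℝ} {ν : Measure ℝ}
    (h : IsDensityOf φ ν) : ν ≪ volume := h.2.2 ▸ withDensity_absolutelyContinuous _ _

theorem one_sub_real_Ioi {ν : Measure ℝ} [IsProbabilityMeasure ν] (t : ℝ) :
    1 - ν.real (Ioi t) = ν.real (Iic t) := by
  rw [← compl_Iic, probReal_compl_eq_one_sub measurableSet_Iic]; ring

/-- The tail function of a log-concave law lies above the geometric chords from the median. -/
theorem IsLogConcave.rpow_two_mul_tail_le {φ : ℝ → ℝ} {ν : Measure ℝ} [IsProbabilityMeasure ν]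
    (hd : IsDensityOf φ ν) (h : IsLogConcave φ) (hmed : ν.real (Ioi 0) = 1 / 2) {x y : ℝ}
    (hx : 0 ≤ x) (hxy : x ≤ y) (hy : 0 < y) :
    (2 * ν.real (Ioi y)) ^ (x / y) ≤ 2 * ν.real (Ioi x) := by
  have hi := hd.integrable
  rcases eq_or_lt_of_le hx with rfl | hx0
  · simp [hmed]
  rcases eq_or_lt_of_le (measureReal_nonneg : 0 ≤ ν.real (Ioi y)) with h0 | hpos
  · rw [← h0, mul_zero, Real.zero_rpow (div_pos hx0 hy).ne']
    positivity
  have hex : ∀ s : Set ℝ, MeasurableSet s → 0 < ν.real s → ∃ z ∈ s, 0 < φ z := by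
    intro s hs hsp
    by_contra! hcon
    rw [hd.real_eq_setIntegral hs, setIntegral_congr_fun (g := fun _ => (0 : ℝ)) hs
      (fun z hz => le_antisymm (hcon z hz) (hd.2.1 z)), integral_zero] at hsp
    exact lt_irrefl _ hsp
  obtain ⟨w, hw, hφw⟩ := hex (Ioi y) measurableSet_Ioi hpos
  obtain ⟨z, hz, hφz⟩ := hex (Iio 0) measurableSet_Iio (by
    have h1 : ν.real (Iio 0) = ν.real (Iic 0) := by
      simp only [Measure.real]
      rw [measure_congr (hd.absolutelyContinuous.ae_eq Iio_ae_eq_Iic)]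
    rw [h1, ← one_sub_real_Ioi, hmed]; norm_num)
  have htail : ∀ r, r ≤ y → 0 < ν.real (Ioi r) := fun r hr =>
    hpos.trans_le (measureReal_mono (Ioi_subset_Ioi hr))
  have hconc := h.concaveOn_log_integral_Ioi hi (a := z) (b := 0) (c := y) (d := w) hz hw hφz hφw
    (fun r hr => by rw [← hd.real_eq_setIntegral measurableSet_Ioi]; exact htail r hr)
  simp only [← hd.real_eq_setIntegral measurableSet_Ioi] at hconc
  -- x = (1 - x/y) · 0 + (x/y) · y; the factor 2 normalizes the tail to 1 at the median.
  have hle := hconc.2 (left_mem_Icc.2 hy.le) (right_mem_Icc.2 hy.le)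
    (show 0 ≤ 1 - x / y by rw [sub_nonneg, div_le_one hy]; exact hxy)
    (show 0 ≤ x / y by positivity) (by ring)
  simp only [smul_eq_mul, mul_zero, zero_add, div_mul_cancel₀ _ hy.ne', hmed] at hle
  have hqx := htail x hxy
  rw [← Real.log_le_log_iff (by positivity) (by positivity), Real.log_rpow (by positivity),
    Real.log_mul two_ne_zero hpos.ne', Real.log_mul two_ne_zero hqx.ne']
  rw [one_div, Real.log_inv] at hle
  linarith

/-! ### Truncated first moments -/

/-- Layer-cake formula for ν restricted to (t, ∞). -/
theorem setIntegral_Ioi_id_eq {ν : Measure ℝ} [IsProbabilityMeasure ν]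
    (hint : Integrable (fun x : ℝ => x) ν) {t : ℝ} (ht : 0 ≤ t) :
    ∫ x in Ioi t, x ∂ν = ∫ s in Ioi 0, ν.real (Ioi (max s t)) := by
  have h0 : 0 ≤ᵐ[ν.restrict (Ioi t)] fun x => x := by
    filter_upwards [ae_restrict_mem measurableSet_Ioi] with x hx
    exact ht.trans (le_of_lt hx)
  rw [hint.integrableOn.integral_eq_integral_meas_lt h0]
  refine integral_congr_ae (Filter.Eventually.of_forall fun s => ?_)
  change (ν.restrict (Ioi t)).real (Ioi s) = ν.real (Ioi (max s t))
  rw [measureReal_restrict_apply measurableSet_Ioi, Ioi_inter_Ioi]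

theorem setIntegral_Ioi_zero_id_pos {ν : Measure ℝ} [IsProbabilityMeasure ν]
    (hint : Integrable (fun x : ℝ => x) ν) (hmed : ν.real (Ioi 0) = 1 / 2) :
    0 < ∫ x in Ioi 0, x ∂ν := by
  rw [setIntegral_pos_iff_support_of_nonneg_ae]
  · have : Function.support (fun x : ℝ => x) ∩ Ioi 0 = Ioi 0 := by
      ext x; simp; intro h; exact h.ne'
    rw [this]
    rw [pos_iff_ne_zero]
    intro h
    rw [Measure.real, h] at hmed
    norm_num at hmed
  · filter_upwards [ae_restrict_mem measurableSet_Ioi] with x hx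
    exact le_of_lt hx
  · exact hint.integrableOn

theorem sq_setIntegral_Ioi_id_le {φ : ℝ → ℝ} {ν : Measure ℝ} [IsProbabilityMeasure ν]
    (hd : IsDensityOf φ ν) (h : IsLogConcave φ) (hint : Integrable (fun x : ℝ => x) ν)
    (hmed : ν.real (Ioi 0) = 1 / 2) {t : ℝ} (ht : 0 ≤ t) :
    (∫ x in Ioi t, x ∂ν) ^ 2 ≤
      4 * (ν.real (Ioi t) * (1 - ν.real (Ioi t))) * (∫ x in Ioi 0, x ∂ν) ^ 2 := by
  have hH0 : ∫ x in Ioi 0, x ∂ν = ∫ s in Ioi 0, ν.real (Ioi s) := by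
    rw [setIntegral_Ioi_id_eq hint le_rfl]
    refine setIntegral_congr_fun measurableSet_Ioi fun s hs => ?_
    simp only [max_eq_left (le_of_lt (mem_Ioi.1 hs))]
  -- A non-integrable tail would have integral 0 by convention, against H(0) > 0.
  have hqi : IntegrableOn (fun s => ν.real (Ioi s)) (Ioi 0) := by
    by_contra hcon
    have := setIntegral_Ioi_zero_id_pos hint hmed
    rw [hH0, integral_undef hcon] at this
    exact lt_irrefl _ this
  have hHt : ∫ x in Ioi t, x ∂ν = t * ν.real (Ioi t) + ∫ s in Ioi t, ν.real (Ioi s) := by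
    rw [setIntegral_Ioi_id_eq hint ht, ← Ioc_union_Ioi_eq_Ioi ht]
    have e1 : EqOn (fun s => ν.real (Ioi (max s t))) (fun _ => ν.real (Ioi t)) (Ioc 0 t) :=
      fun s hs => by simp only [max_eq_right hs.2]
    have e2 : EqOn (fun s => ν.real (Ioi (max s t))) (fun s => ν.real (Ioi s)) (Ioi t) :=
      fun s hs => by simp only [max_eq_left (le_of_lt (mem_Ioi.1 hs))]
    rw [setIntegral_union (Ioc_disjoint_Ioi le_rfl) measurableSet_Ioi,
      setIntegral_congr_fun measurableSet_Ioc e1, setIntegral_congr_fun measurableSet_Ioi e2]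
    · simp [ht]
    · exact (integrableOn_congr_fun e1 measurableSet_Ioc).2 (by simp)
    · exact (integrableOn_congr_fun e2 measurableSet_Ioi).2
        (hqi.mono_set (Ioi_subset_Ioi ht))
  have key := sq_mul_add_integral_Ioi_le (f := fun x => 2 * ν.real (Ioi x))
    (by simp [hmed]) (fun x => by positivity)
    (fun x y hxy => by
      have : ν.real (Ioi y) ≤ ν.real (Ioi x) := measureReal_mono (Ioi_subset_Ioi hxy)
      simpa using this)
    (hqi.const_mul 2) (fun x y hx hxy hy => h.rpow_two_mul_tail_le hd hmed hx hxy hy) ht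
  simp only [integral_const_mul] at key
  rw [← hH0] at key
  rw [hHt]
  nlinarith [key]

theorem HasWeaklySymmetricLogConcaveDensity.real_Iic_zero {ν : Measure ℝ}
    [IsProbabilityMeasure ν] (h : HasWeaklySymmetricLogConcaveDensity ν)
    (h0 : ∫ x, x ∂ν = 0) : ν.real (Iic 0) = 1 / 2 := by
  obtain ⟨φ, hd, -, hw⟩ := h
  rw [hd.real_eq_setIntegral measurableSet_Iic]
  have := hw.2
  rwa [← hd.integral_id_eq, h0] at this

theorem map_withDensity_comp {α : Type*} [MeasurableSpace α] {m : Measure α} {T : α → α}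
    (hT : MeasurePreserving T m m) {f : α → ENNReal} (hf : Measurable f) :
    (m.withDensity (fun x => f (T x))).map T = m.withDensity f := by
  ext s hs
  rw [Measure.map_apply hT.measurable hs, withDensity_apply _ (hT.measurable hs),
    withDensity_apply _ hs, hT.setLIntegral_comp_preimage hs hf]

/-! ### Reflections adapted to the scatter matrix -/

section Reflection

variable {E : Type*} [NormedAddCommGroup E] [InnerProductSpace ℝ E]

/-- The reflection `y ↦ y - 2 ⟨a, y⟩ / ⟨a, L a⟩ • L a`. For positive definite `L` it is the
reflection in the hyperplane orthogonal to `a` along `L a`. -/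
noncomputable def scatterReflection (L : E →ₗ[ℝ] E) (a : E) : E →ₗ[ℝ] E :=
  LinearMap.id - (2 / inner ℝ a (L a)) • (innerₗ E a).smulRight (L a)

theorem scatterReflection_apply (L : E →ₗ[ℝ] E) (a y : E) :
    scatterReflection L a y = y - (2 / inner ℝ a (L a) * inner ℝ a y) • L a := by
  simp [scatterReflection, smul_smul]

theorem scatterReflection_scatterReflection {L : E →ₗ[ℝ] E} {a : E} (ha : inner ℝ a (L a) ≠ 0)
    (y : E) : scatterReflection L a (scatterReflection L a y) = y := by
  simp only [scatterReflection_apply, inner_sub_right, real_inner_smul_right]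
  rw [sub_sub, ← add_smul]
  have : 2 / inner ℝ a (L a) * inner ℝ a y + 2 / inner ℝ a (L a) *
      (inner ℝ a y - 2 / inner ℝ a (L a) * inner ℝ a y * inner ℝ a (L a)) = 0 := by
    field_simp; ring
  rw [this, zero_smul, sub_zero]

theorem inner_scatterReflection_self {L : E →ₗ[ℝ] E} {a : E} (ha : inner ℝ a (L a) ≠ 0) (y : E) :
    inner ℝ (scatterReflection L a y) a = -inner ℝ y a := by
  simp only [scatterReflection_apply, inner_sub_left, real_inner_smul_left]
  rw [real_inner_comm a (L a), real_inner_comm y a]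
  field_simp; ring

theorem inner_scatterReflection_of_inner_eq_zero {L : E →ₗ[ℝ] E} {a u : E}
    (hau : inner ℝ (L a) u = 0) (y : E) :
    inner ℝ (scatterReflection L a y) u = inner ℝ y u := by
  simp [scatterReflection_apply, inner_sub_left, real_inner_smul_left, hau]

/-- As for Householder reflections, the adjoint exchanges two vectors on the same level set of the
form of L: equal values give ⟨a, L a⟩ = 2⟨L a, u⟩ for a = u - v. -/
theorem inner_scatterReflection_sub {L : E →ₗ[ℝ] E} (hL : L.IsSymmetric) {u v : E}
    (huv : inner ℝ u (L u) = inner ℝ v (L v)) (hne : inner ℝ (u - v) (L (u - v)) ≠ 0) (y : E) :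
    inner ℝ (scatterReflection L (u - v) y) u = inner ℝ y v := by
  have h1 : inner ℝ (u - v) (L (u - v)) = 2 * inner ℝ (L (u - v)) u := by
    have := hL u v
    simp only [map_sub, inner_sub_left, inner_sub_right]
    rw [hL u u, hL v u, ← this, real_inner_comm v (L u)]
    linarith
  have h2 : inner ℝ (L (u - v)) u ≠ 0 := fun h => hne (by rw [h1, h, mul_zero])
  rw [scatterReflection_apply, inner_sub_left, real_inner_smul_left, h1, inner_sub_left u v y,
    real_inner_comm y v, real_inner_comm y u]
  field_simp; ring

/-- With K = L⁻¹ this is the invariance of the quadratic form in the elliptical density. -/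
theorem inner_scatterReflection_map {L K : E →ₗ[ℝ] E} (hK : K.IsSymmetric)
    (hKL : ∀ x, K (L x) = x) {a : E} (ha : inner ℝ a (L a) ≠ 0) (y : E) :
    inner ℝ (scatterReflection L a y) (K (scatterReflection L a y)) = inner ℝ y (K y) := by
  have h1 : inner ℝ (L a) (K y) = inner ℝ a y := by rw [← hK, hKL]
  simp only [scatterReflection_apply, map_sub, map_smul, hKL, inner_sub_left, inner_sub_right,
    real_inner_smul_left, real_inner_smul_right, h1]
  rw [real_inner_comm a (L a), real_inner_comm a y]
  field_simp; ring

variable [FiniteDimensional ℝ E] [MeasurableSpace E] [BorelSpace E]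

/-- An involution has determinant ±1. -/
theorem measurePreserving_scatterReflection {L : E →ₗ[ℝ] E} {a : E}
    (ha : inner ℝ a (L a) ≠ 0) :
    MeasurePreserving (scatterReflection L a) (volume : Measure E) volume := by
  have hmul : scatterReflection L a * scatterReflection L a = 1 :=
    LinearMap.ext fun y => scatterReflection_scatterReflection ha y
  have hdet : LinearMap.det (scatterReflection L a) * LinearMap.det (scatterReflection L a) = 1 := by
    rw [← map_mul, hmul, map_one]
  have habs : |LinearMap.det (scatterReflection L a)| = 1 := by
    rcases mul_self_eq_one_iff.1 hdet with h | h <;> simp [h]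
  refine ⟨(LinearMap.continuous_of_finiteDimensional _).measurable, ?_⟩
  rw [Measure.map_linearMap_addHaar_eq_smul_addHaar _ (left_ne_zero_of_mul_eq_one hdet),
    abs_inv, habs]
  simp

end Reflection

/-! ### The spectral quotient -/

section Spectral

variable {E : Type*} [NormedAddCommGroup E] [InnerProductSpace ℝ E] [FiniteDimensional ℝ E]

/-- Maximizers of `‖L v‖² / ⟨v, L v⟩` are the eigenvectors of the largest eigenvalue. -/
theorem exists_isGreatest_eigenvalue_forall_maximizer_iff [Nontrivial E] {L : E →ₗ[ℝ] E}
    (hL : L.IsSymmetric) (hpos : ∀ x, x ≠ 0 → 0 < inner ℝ x (L x)) :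
    ∃ lam : ℝ, IsGreatest {r : ℝ | End.HasEigenvalue L r} lam ∧
      ∀ u : E, ‖u‖ = 1 →
        ((∀ v : E, ‖v‖ = 1 → ‖L v‖ ^ 2 / inner ℝ v (L v) ≤ ‖L u‖ ^ 2 / inner ℝ u (L u)) ↔
          End.HasEigenvector L lam u) := by
  have : Nonempty (Fin (finrank ℝ E)) := Fin.pos_iff_nonempty.1 finrank_pos
  obtain ⟨i₀, hi₀⟩ := Finite.exists_max (hL.eigenvalues rfl)
  set b := hL.eigenvectorBasis rfl with hb
  set l := hL.eigenvalues rfl with hl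
  have hcoef : ∀ i x, inner ℝ (b i) (L x) = l i * inner ℝ (b i) x := by
    intro i x
    rw [← hL, hL.apply_eigenvectorBasis rfl i, real_inner_smul_left]; rfl
  have hlpos : ∀ i, 0 < l i := by
    intro i
    have h := hpos (b i) (b.orthonormal.ne_zero i)
    rw [hcoef, real_inner_self_eq_norm_sq, b.orthonormal.1 i] at h
    simpa using h
  have hquad : ∀ x, inner ℝ x (L x) = ∑ i, l i * inner ℝ (b i) x ^ 2 := by
    intro x
    rw [← b.sum_inner_mul_inner x (L x)]
    refine Finset.sum_congr rfl fun i _ => ?_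
    rw [hcoef, real_inner_comm x (b i)]; ring
  have hnorm : ∀ x, ‖x‖ ^ 2 = ∑ i, inner ℝ (b i) x ^ 2 := by
    intro x
    rw [← b.sum_sq_norm_inner_right x]
    simp
  -- All terms are nonnegative, so equality kills every coordinate outside the top eigenspace.
  have hgap : ∀ x, l i₀ * inner ℝ x (L x) - ‖L x‖ ^ 2 =
      ∑ i, l i * (l i₀ - l i) * inner ℝ (b i) x ^ 2 := by
    intro x
    rw [hquad, hnorm, Finset.mul_sum, ← Finset.sum_sub_distrib]
    refine Finset.sum_congr rfl fun i _ => ?_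
    rw [hcoef]; ring
  have hterm : ∀ x i, 0 ≤ l i * (l i₀ - l i) * inner ℝ (b i) x ^ 2 := fun x i =>
    mul_nonneg (mul_nonneg (hlpos i).le (sub_nonneg.2 (hi₀ i))) (sq_nonneg _)
  have hle : ∀ x, ‖L x‖ ^ 2 ≤ l i₀ * inner ℝ x (L x) := fun x => by
    rw [← sub_nonneg, hgap]; exact Finset.sum_nonneg fun i _ => hterm x i
  have hne : ∀ {x : E}, ‖x‖ = 1 → x ≠ 0 := fun hx h => by simp [h] at hx
  have heig : ∀ {r : ℝ} {x : E}, End.HasEigenvector L r x →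
      ‖L x‖ ^ 2 / inner ℝ x (L x) = r := by
    intro r x hx
    have h := hpos x hx.2
    rw [div_eq_iff h.ne', hx.apply_eq_smul, ← real_inner_self_eq_norm_sq, real_inner_smul_left]
  refine ⟨l i₀, ⟨hL.hasEigenvalue_eigenvalues rfl i₀, ?_⟩, fun u hu => ⟨fun hmax => ?_, ?_⟩⟩
  · intro r hr
    obtain ⟨x, hx⟩ := End.HasEigenvalue.exists_hasEigenvector hr
    rw [← heig hx, div_le_iff₀ (hpos x hx.2)]
    exact hle x
  · have h := hmax (b i₀) (b.orthonormal.1 i₀)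
    rw [heig (hL.hasEigenvector_eigenvectorBasis rfl i₀), le_div_iff₀ (hpos u (hne hu))] at h
    have hsum : ∑ i, l i * (l i₀ - l i) * inner ℝ (b i) u ^ 2 = 0 := by
      rw [← hgap]; exact sub_eq_zero.2 (le_antisymm h (hle u))
    rw [Finset.sum_eq_zero_iff_of_nonneg fun i _ => hterm u i] at hsum
    refine End.hasEigenvector_iff.2 ⟨End.mem_eigenspace_iff.2 ?_, hne hu⟩
    refine b.repr.injective (WithLp.ofLp_injective 2 (funext fun i => ?_))
    rw [b.repr_apply_apply, b.repr_apply_apply, hcoef, real_inner_smul_right]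
    rcases mul_eq_zero.1 (hsum i (Finset.mem_univ i)) with h1 | h1
    · rcases mul_eq_zero.1 h1 with h2 | h2
      · exact absurd h2 (hlpos i).ne'
      · rw [sub_eq_zero.1 h2]
    · rw [pow_eq_zero_iff two_ne_zero] at h1
      rw [h1]; ring
  · intro hu' v hv
    rw [heig hu', div_le_iff₀ (hpos v (hne hv))]
    exact hle v

end Spectral

/-! ### Moments under reflection invariance -/

section Halfspaces

variable {Ω : Type*} [MeasurableSpace Ω] {P : Measure Ω} {E : Type*} [NormedAddCommGroup E]
  [InnerProductSpace ℝ E] [FiniteDimensional ℝ E] [MeasurableSpace E] [BorelSpace E]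
  {Y : Ω → E} {L : E →ₗ[ℝ] E}

/-- The reflection along `L a` preserves the event and flips the sign of the integrand. -/
theorem setIntegral_inner_eq_zero (hYm : Measurable Y)
    (hR : ∀ a, inner ℝ a (L a) ≠ 0 →
      ProbabilityTheory.IdentDistrib Y (fun ω => scatterReflection L a (Y ω)) P P)
    (hpos : ∀ x, x ≠ 0 → 0 < inner ℝ x (L x)) {a u : E} (hau : inner ℝ (L a) u = 0) (t : ℝ) :
    ∫ ω in {ω | inner ℝ (Y ω) u ≤ t}, inner ℝ (Y ω) a ∂P = 0 := by
  rcases eq_or_ne a 0 with rfl | ha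
  · simp
  have hne := (hpos a ha).ne'
  have hms : MeasurableSet {y : E | inner ℝ y u ≤ t} :=
    measurableSet_le (by fun_prop) measurable_const
  have hf : Measurable ({y : E | inner ℝ y u ≤ t}.indicator fun y => inner ℝ y a) :=
    Measurable.indicator (by fun_prop) hms
  have hRm : Measurable (scatterReflection L a) :=
    (LinearMap.continuous_of_finiteDimensional _).measurable
  have h := ((hR a hne).comp hf).integral_eq
  have e1 : ∀ Z : Ω → E, Measurable Z →
      ∫ ω, (({y : E | inner ℝ y u ≤ t}.indicator fun y => inner ℝ y a) ∘ Z) ω ∂P =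
        ∫ ω in {ω | inner ℝ (Z ω) u ≤ t}, inner ℝ (Z ω) a ∂P := by
    intro Z hZ
    exact integral_indicator (f := fun ω => inner ℝ (Z ω) a) (hZ hms)
  rw [e1 _ hYm, e1 (fun ω => scatterReflection L a (Y ω)) (hRm.comp hYm)] at h
  simp only [inner_scatterReflection_of_inner_eq_zero hau, inner_scatterReflection_self hne,
    integral_neg] at h
  linarith

/-- Any test vector x splits as s u plus a vector L-orthogonal to u, and the latter contributes
nothing. -/
theorem setIntegral_halfspace_eq (hYm : Measurable Y) (hYi : Integrable Y P)
    (hR : ∀ a, inner ℝ a (L a) ≠ 0 →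
      ProbabilityTheory.IdentDistrib Y (fun ω => scatterReflection L a (Y ω)) P P)
    (hL : L.IsSymmetric) (hpos : ∀ x, x ≠ 0 → 0 < inner ℝ x (L x)) {u : E} (hu : u ≠ 0) (t : ℝ) :
    ∫ ω in {ω | inner ℝ (Y ω) u ≤ t}, Y ω ∂P =
      ((∫ ω in {ω | inner ℝ (Y ω) u ≤ t}, inner ℝ (Y ω) u ∂P) / inner ℝ u (L u)) • L u := by
  have hq := (hpos u hu).ne'
  have hinner : ∀ x, inner ℝ x (∫ ω in {ω | inner ℝ (Y ω) u ≤ t}, Y ω ∂P) =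
      ∫ ω in {ω | inner ℝ (Y ω) u ≤ t}, inner ℝ (Y ω) x ∂P := by
    intro x
    rw [← integral_inner hYi.integrableOn]
    simp only [real_inner_comm x]
  refine ext_inner_left ℝ fun x => ?_
  set s := inner ℝ x (L u) / inner ℝ u (L u) with hs
  have ha : inner ℝ (L (x - s • u)) u = 0 := by
    rw [hL, inner_sub_left, real_inner_smul_left, hs, div_mul_cancel₀ _ hq, sub_self]
  have h0 := setIntegral_inner_eq_zero hYm hR hpos ha t
  rw [← hinner, inner_sub_left, real_inner_smul_left, hinner u] at h0
  rw [real_inner_smul_right, sub_eq_zero.1 h0, hs]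
  ring

/-- By reflection E|⟨Y, u⟩| depends only on ⟨u, L u⟩; homogeneity then makes its square proportional
to that value. -/
theorem sq_integral_abs_inner_mul (hR : ∀ a, inner ℝ a (L a) ≠ 0 →
      ProbabilityTheory.IdentDistrib Y (fun ω => scatterReflection L a (Y ω)) P P)
    (hL : L.IsSymmetric) (hpos : ∀ x, x ≠ 0 → 0 < inner ℝ x (L x)) {u v : E}
    (hu : u ≠ 0) (hv : v ≠ 0) :
    (∫ ω, |inner ℝ (Y ω) u| ∂P) ^ 2 * inner ℝ v (L v) =
      (∫ ω, |inner ℝ (Y ω) v| ∂P) ^ 2 * inner ℝ u (L u) := by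
  have hequal : ∀ x y : E, inner ℝ x (L x) = inner ℝ y (L y) →
      ∫ ω, |inner ℝ (Y ω) x| ∂P = ∫ ω, |inner ℝ (Y ω) y| ∂P := by
    intro x y hxy
    rcases eq_or_ne x y with rfl | hne
    · rfl
    have hne' := (hpos (x - y) (sub_ne_zero.2 hne)).ne'
    have h := ((hR (x - y) hne').comp
      (u := fun z : E => |inner ℝ z x|) (by fun_prop)).integral_eq
    simpa only [Function.comp_def, inner_scatterReflection_sub hL hxy hne'] using h
  have h := hequal (√(inner ℝ v (L v)) • u) (√(inner ℝ u (L u)) • v) (by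
    simp only [map_smul, real_inner_smul_left, real_inner_smul_right]
    rw [← mul_assoc, ← mul_assoc, Real.mul_self_sqrt (hpos v hv).le,
      Real.mul_self_sqrt (hpos u hu).le, mul_comm])
  simp only [real_inner_smul_right, abs_mul, abs_of_nonneg (Real.sqrt_nonneg _),
    integral_const_mul] at h
  have h2 := congrArg (· ^ 2) h
  simp only [mul_pow, Real.sq_sqrt (hpos v hv).le, Real.sq_sqrt (hpos u hu).le] at h2
  linarith

end Halfspaces

/-! ### Elliptical laws and the centred objective -/

section Elliptical

variable {Ω : Type*} [MeasurableSpace Ω] {P : Measure Ω} {d : ℕ}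
  {X : Ω → EuclideanSpace ℝ (Fin d)}

theorem inner_toEuclideanLin (A : Matrix (Fin d) (Fin d) ℝ) (x : EuclideanSpace ℝ (Fin d)) :
    inner ℝ x (Matrix.toEuclideanLin A x) = x.ofLp ⬝ᵥ A.mulVec x.ofLp := by
  rw [EuclideanSpace.inner_eq_star_dotProduct, dotProduct_comm]
  simp

theorem identDistrib_scatterReflection (hXm : Measurable X) {μ : EuclideanSpace ℝ (Fin d)}
    {S : Matrix (Fin d) (Fin d) ℝ} (hS : S.PosDef) (hell : HasEllipticalDensity (P.map X) μ S)
    {a : EuclideanSpace ℝ (Fin d)} (ha : inner ℝ a (Matrix.toEuclideanLin S a) ≠ 0) :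
    ProbabilityTheory.IdentDistrib (fun ω => X ω - μ)
      (fun ω => scatterReflection (Matrix.toEuclideanLin S) a (X ω - μ)) P P := by
  obtain ⟨g, C, hg, -, -, -, hX⟩ := hell
  set R := scatterReflection (Matrix.toEuclideanLin S) a with hRdef
  have hRm : Measurable R := (LinearMap.continuous_of_finiteDimensional _).measurable
  have hYm : Measurable fun ω => X ω - μ := hXm.sub_const μ
  have hK : (Matrix.toEuclideanLin S⁻¹).IsSymmetric :=
    Matrix.isSymmetric_toEuclideanLin_iff.2 hS.isHermitian.inv
  have hKL : ∀ x, Matrix.toEuclideanLin S⁻¹ (Matrix.toEuclideanLin S x) = x := by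
    intro x
    have hdet : IsUnit S.det := hS.isUnit.map Matrix.detMonoidHom
    apply (WithLp.ofLp_injective 2)
    simp [Matrix.mulVec_mulVec, Matrix.nonsing_inv_mul S hdet]
  set D : EuclideanSpace ℝ (Fin d) → ENNReal := fun y =>
    ENNReal.ofReal (C * S.det ^ (-(1 / 2) : ℝ) * g (y.ofLp ⬝ᵥ (S⁻¹.mulVec y.ofLp))) with hD
  have hDm : Measurable D := by
    have hq : Continuous fun y : EuclideanSpace ℝ (Fin d) => y.ofLp ⬝ᵥ (S⁻¹.mulVec y.ofLp) := by
      simp only [← inner_toEuclideanLin]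
      exact continuous_id.inner (LinearMap.continuous_of_finiteDimensional _)
    exact ((hg.comp hq.measurable).const_mul _).ennreal_ofReal
  have hDR : (fun y => D (R y)) = D := by
    ext y
    simp only [hD, ← inner_toEuclideanLin]
    rw [inner_scatterReflection_map hK hKL ha]
  have hlaw : P.map (fun ω => X ω - μ) = volume.withDensity D := by
    rw [← map_withDensity_comp (measurePreserving_sub_right volume μ) hDm]
    change P.map ((fun x => x - μ) ∘ X) = _
    rw [← Measure.map_map (f := X) (g := fun x => x - μ) (measurable_id.sub_const μ) hXm, hX]
  refine ⟨hYm.aemeasurable, (hRm.comp hYm).aemeasurable, ?_⟩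
  change _ = P.map (R ∘ fun ω => X ω - μ)
  rw [← Measure.map_map hRm hYm, hlaw]
  conv_rhs => rw [← hDR]
  rw [map_withDensity_comp (measurePreserving_scatterReflection ha) hDm]

theorem measurableSet_halfspace (m u : EuclideanSpace ℝ (Fin d)) (t : ℝ) :
    MeasurableSet (halfspace m u t) :=
  measurableSet_le (by fun_prop) measurable_const

theorem regimeObjective_eq [IsProbabilityMeasure P] (hXm : Measurable X) (hXi : Integrable X P)
    {A : Set (EuclideanSpace ℝ (Fin d))} (hA : MeasurableSet A) :
    regimeObjective P X A = ‖∫ ω, X ω ∂P‖ ^ 2 +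
      ‖∫ ω in X ⁻¹' A, (X ω - ∫ ω', X ω' ∂P) ∂P‖ ^ 2 /
        (P.real (X ⁻¹' A) * P.real (X ⁻¹' Aᶜ)) := by
  set μ := ∫ ω, X ω ∂P with hμ
  set w := ∫ ω in X ⁻¹' A, (X ω - μ) ∂P with hw
  set p := P.real (X ⁻¹' A) with hp
  set q := P.real (X ⁻¹' Aᶜ) with hq
  have hAm : MeasurableSet (X ⁻¹' A) := hXm hA
  have hpq : p + q = 1 := by
    rw [hp, hq, preimage_compl, probReal_compl_eq_one_sub hAm]; ring
  have h1 : ∫ ω in X ⁻¹' A, X ω ∂P = w + p • μ := by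
    rw [hw, integral_sub hXi.integrableOn (integrable_const _)]
    simp [hp]
  have h2 : ∫ ω in X ⁻¹' Aᶜ, X ω ∂P = -w + q • μ := by
    have := integral_add_compl hAm hXi
    rw [← preimage_compl, h1, ← hμ] at this
    have h3 : μ = p • μ + q • μ := by rw [← add_smul, hpq, one_smul]
    rw [eq_sub_of_add_eq' (this.trans h3)]
    abel
  -- If one event is null then w = 0, so the formula survives the convention 0 / 0 = 0.
  have hp0 : p = 0 → w = 0 := fun h => by
    rw [hw, Measure.restrict_eq_zero.2 ((measureReal_eq_zero_iff).1 h), integral_zero_measure]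
  have hq0 : q = 0 → w = 0 := fun h => by
    rw [Measure.restrict_eq_zero.2 ((measureReal_eq_zero_iff).1 h), integral_zero_measure, h,
      zero_smul, add_zero, zero_eq_neg] at h2
    exact h2
  rw [regimeObjective, h1, h2, ← hp, ← hq]
  by_cases hw0 : w = 0
  · simp only [hw0, neg_zero, zero_add, norm_smul, norm_zero, mul_pow, Real.norm_eq_abs, sq_abs]
    have e : ∀ r : ℝ, r ^ 2 * ‖μ‖ ^ 2 / r = r * ‖μ‖ ^ 2 := fun r => by
      rcases eq_or_ne r 0 with rfl | hr
      · simp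
      · field_simp
    rw [e, e, ← add_mul, hpq]; simp
  have hp' : p ≠ 0 := fun h => hw0 (hp0 h)
  have hq' : q ≠ 0 := fun h => hw0 (hq0 h)
  rw [norm_add_sq_real, norm_add_sq_real]
  simp only [norm_neg, norm_smul, inner_neg_left, real_inner_smul_right, mul_pow,
    Real.norm_eq_abs, sq_abs]
  have e : ‖w‖ ^ 2 / (p * q) = ‖w‖ ^ 2 / p + ‖w‖ ^ 2 / q := by
    field_simp; rw [add_comm, hpq]
  have e1 : (‖w‖ ^ 2 + 2 * (p * inner ℝ w μ) + p ^ 2 * ‖μ‖ ^ 2) / p =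
      ‖w‖ ^ 2 / p + 2 * inner ℝ w μ + p * ‖μ‖ ^ 2 := by field_simp
  have e2 : (‖w‖ ^ 2 + 2 * -(q * inner ℝ w μ) + q ^ 2 * ‖μ‖ ^ 2) / q =
      ‖w‖ ^ 2 / q - 2 * inner ℝ w μ + q * ‖μ‖ ^ 2 := by field_simp; ring
  rw [e, e1, e2]
  have : ‖μ‖ ^ 2 = p * ‖μ‖ ^ 2 + q * ‖μ‖ ^ 2 := by rw [← add_mul, hpq, one_mul]
  linarith

theorem regimeObjective_congr_compl {A B : Set (EuclideanSpace ℝ (Fin d))}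
    (h : X ⁻¹' A =ᵐ[P] X ⁻¹' Bᶜ) : regimeObjective P X A = regimeObjective P X B := by
  have h' : X ⁻¹' Aᶜ =ᵐ[P] X ⁻¹' B := by
    have h2 := h.compl
    rwa [← preimage_compl, ← preimage_compl, compl_compl] at h2
  rw [regimeObjective, regimeObjective, setIntegral_congr_set h, setIntegral_congr_set h',
    Measure.real, Measure.real, measure_congr h, measure_congr h', add_comm]
  rfl

end Elliptical

/-! ### The functional through one-dimensional projections -/

section Assembly

variable {Ω : Type*} [MeasurableSpace Ω] {P : Measure Ω} {d : ℕ}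
  {X : Ω → EuclideanSpace ℝ (Fin d)} {μ : EuclideanSpace ℝ (Fin d)}

theorem integrable_inner_sub [IsProbabilityMeasure P] (hXi : Integrable X P)
    (u : EuclideanSpace ℝ (Fin d)) :
    Integrable (fun ω => inner ℝ (X ω - μ) u) P :=
  (hXi.sub (integrable_const μ)).inner_const u

theorem integral_inner_sub [IsProbabilityMeasure P] (hXi : Integrable X P) (hXμ : ∫ ω, X ω ∂P = μ)
    (u : EuclideanSpace ℝ (Fin d)) : ∫ ω, inner ℝ (X ω - μ) u ∂P = 0 := by
  have h := integral_inner (𝕜 := ℝ) (hXi.sub (integrable_const μ)) u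
  simp only [Pi.sub_apply] at h
  rw [integral_sub hXi (integrable_const μ), hXμ] at h
  simp only [integral_const, probReal_univ, one_smul, sub_self, inner_zero_right] at h
  simpa only [real_inner_comm u] using h

/-- The halfspace functional in terms of the law `ν` of the projection `⟨X - μ, u⟩`. -/
theorem halfspaceFunctional_eq [IsProbabilityMeasure P] (hXm : Measurable X) (hXi : Integrable X P)
    (hXμ : ∫ ω, X ω ∂P = μ) {S : Matrix (Fin d) (Fin d) ℝ} (hS : S.PosDef)
    (hell : HasEllipticalDensity (P.map X) μ S)
    (hpos : ∀ x, x ≠ 0 → 0 < inner ℝ x (Matrix.toEuclideanLin S x))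
    {u : EuclideanSpace ℝ (Fin d)} (hu : u ≠ 0) {ν : Measure ℝ}
    (hν : P.map (fun ω => inner ℝ (X ω - μ) u) = ν) (t : ℝ) :
    halfspaceFunctional P X u t = ‖μ‖ ^ 2 +
      ‖Matrix.toEuclideanLin S u‖ ^ 2 / inner ℝ u (Matrix.toEuclideanLin S u) ^ 2 *
        ((∫ x in Ioi t, x ∂ν) ^ 2 / (ν.real (Ioi t) * (1 - ν.real (Ioi t)))) := by
  have hZm : Measurable fun ω => inner ℝ (X ω - μ) u := by fun_prop
  have : IsProbabilityMeasure ν := hν ▸ Measure.isProbabilityMeasure_map hZm.aemeasurable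
  have hZi := integrable_inner_sub (μ := μ) hXi u
  have hIic : P.real (X ⁻¹' halfspace μ u t) = ν.real (Iic t) := by
    rw [← hν, map_measureReal_apply hZm measurableSet_Iic]; rfl
  have hIoi : P.real (X ⁻¹' (halfspace μ u t)ᶜ) = ν.real (Ioi t) := by
    rw [preimage_compl, probReal_compl_eq_one_sub (hXm (measurableSet_halfspace μ u t)), hIic,
      ← one_sub_real_Ioi]; ring
  have hh : ∫ ω in {ω | inner ℝ (X ω - μ) u ≤ t}, inner ℝ (X ω - μ) u ∂P =
      -∫ x in Ioi t, x ∂ν := by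
    have h1 : ∫ x in Ioi t, x ∂ν =
        ∫ ω in {ω | inner ℝ (X ω - μ) u ≤ t}ᶜ, inner ℝ (X ω - μ) u ∂P := by
      rw [← hν, setIntegral_map (f := fun x : ℝ => x) measurableSet_Ioi
        aestronglyMeasurable_id hZm.aemeasurable]
      congr 2
      ext ω; simp
    have h2 := integral_add_compl (hZm (measurableSet_Iic (a := t))) hZi
    rw [integral_inner_sub hXi hXμ u] at h2
    rw [h1]
    exact eq_neg_of_add_eq_zero_left h2
  have hw := setIntegral_halfspace_eq (hXm.sub_const μ) (hXi.sub (integrable_const μ))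
    (fun a ha => identDistrib_scatterReflection hXm hS hell ha)
    (Matrix.isSymmetric_toEuclideanLin_iff.2 hS.isHermitian) hpos hu t
  rw [halfspaceFunctional, hXμ, regimeObjective_eq hXm hXi (measurableSet_halfspace μ u t), hXμ,
    hIic, hIoi, one_sub_real_Ioi, mul_comm (ν.real (Ioi t))]
  rw [hh] at hw
  have hw' : ∫ ω in X ⁻¹' halfspace μ u t, (X ω - μ) ∂P =
      (-(∫ x in Ioi t, x ∂ν) / inner ℝ u (Matrix.toEuclideanLin S u)) •
        Matrix.toEuclideanLin S u := hw
  rw [hw', norm_smul, mul_pow, Real.norm_eq_abs, sq_abs]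
  ring

/-- The sign change exchanges the two halfspaces up to the bounding hyperplane, which is null. -/
theorem halfspaceFunctional_neg_neg (hXm : Measurable X) (hXμ : ∫ ω, X ω ∂P = μ)
    {u : EuclideanSpace ℝ (Fin d)}
    (hac : P.map (fun ω => inner ℝ (X ω - μ) u) ≪ volume) (t : ℝ) :
    halfspaceFunctional P X (-u) (-t) = halfspaceFunctional P X u t := by
  rw [halfspaceFunctional, halfspaceFunctional, hXμ]
  apply regimeObjective_congr_compl
  have hZm : Measurable fun ω => inner ℝ (X ω - μ) u := by fun_prop
  have h : ∀ᵐ ω ∂P, inner ℝ (X ω - μ) u ≠ t := by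
    refine ae_of_ae_map (p := fun x => x ≠ t) hZm.aemeasurable (hac.ae_le ?_)
    exact Measure.ae_ne volume t
  filter_upwards [h] with ω hω
  apply propext
  change inner ℝ (X ω - μ) (-u) ≤ -t ↔ ¬ inner ℝ (X ω - μ) u ≤ t
  rw [inner_neg_right, neg_le_neg_iff, not_le, lt_iff_le_and_ne]
  exact ⟨fun h => ⟨h, hω.symm⟩, fun h => h.1⟩

end Assembly

/-! ### The main theorem -/

theorem theorem2 {Ω : Type*} [MeasurableSpace Ω] (P : Measure Ω) [IsProbabilityMeasure P]
    {d : ℕ} (hd : 1 ≤ d) (X : Ω → EuclideanSpace ℝ (Fin d)) (hXm : Measurable X)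
    (μ : EuclideanSpace ℝ (Fin d)) (hXi : Integrable X P) (hXμ : ∫ ω, X ω ∂P = μ)
    (S : Matrix (Fin d) (Fin d) ℝ) (hS : S.PosDef)
    (hell : HasEllipticalDensity (P.map X) μ S)
    (hproj : ∀ u : EuclideanSpace ℝ (Fin d), ‖u‖ = 1 →
      HasWeaklySymmetricLogConcaveDensity (P.map (fun ω => inner ℝ (X ω - μ) u))) :
    (∀ u : EuclideanSpace ℝ (Fin d), ‖u‖ = 1 →
      ∀ t : ℝ, halfspaceFunctional P X u t ≤ halfspaceFunctional P X u 0) ∧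
    (∃ lam : ℝ, IsGreatest {r : ℝ | End.HasEigenvalue (Matrix.toEuclideanLin S) r} lam ∧
      ∀ u : EuclideanSpace ℝ (Fin d), ‖u‖ = 1 →
        ((∀ v : EuclideanSpace ℝ (Fin d), ‖v‖ = 1 →
            halfspaceFunctional P X v 0 ≤ halfspaceFunctional P X u 0) ↔
          End.HasEigenvector (Matrix.toEuclideanLin S) lam u)) := by
  have hpos : ∀ x, x ≠ 0 → 0 < inner ℝ x (Matrix.toEuclideanLin S x) := by
    intro x hx
    rw [inner_toEuclideanLin]
    have := hS.dotProduct_mulVec_pos (x := x.ofLp) (fun h => hx (WithLp.ofLp_injective 2 h))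
    simpa using this
  have hL : (Matrix.toEuclideanLin S).IsSymmetric :=
    Matrix.isSymmetric_toEuclideanLin_iff.2 hS.isHermitian
  have hne : ∀ {u : EuclideanSpace ℝ (Fin d)}, ‖u‖ = 1 → u ≠ 0 := fun hu h => by simp [h] at hu
  have hZm : ∀ u, Measurable fun ω => inner ℝ (X ω - μ) u := fun u => by fun_prop
  have hprob : ∀ u, IsProbabilityMeasure (P.map fun ω => inner ℝ (X ω - μ) u) := fun u =>
    Measure.isProbabilityMeasure_map (hZm u).aemeasurable
  have hmean : ∀ u, ∫ x, x ∂(P.map fun ω => inner ℝ (X ω - μ) u) = 0 := fun u => by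
    rw [integral_map (f := fun x : ℝ => x) (hZm u).aemeasurable aestronglyMeasurable_id,
      integral_inner_sub hXi hXμ]
  have hint : ∀ u, Integrable (fun x : ℝ => x) (P.map fun ω => inner ℝ (X ω - μ) u) := fun u =>
    (integrable_map_measure aestronglyMeasurable_id (hZm u).aemeasurable).2
      (integrable_inner_sub hXi u)
  have hmed : ∀ u, ‖u‖ = 1 → (P.map fun ω => inner ℝ (X ω - μ) u).real (Ioi 0) = 1 / 2 := by
    intro u hu
    have := hprob u
    have h1 := (hproj u hu).real_Iic_zero (hmean u)
    rw [← one_sub_real_Ioi] at h1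
    linarith
  have hF : ∀ u, ‖u‖ = 1 → ∀ t, _ := fun u hu t =>
    halfspaceFunctional_eq hXm hXi hXμ hS hell hpos (hne hu) rfl t
  have hnonneg : ∀ u, ‖u‖ = 1 → ∀ t, 0 ≤ t →
      halfspaceFunctional P X u t ≤ halfspaceFunctional P X u 0 := by
    intro u hu t ht
    have := hprob u
    rw [hF u hu t, hF u hu 0, hmed u hu]
    obtain ⟨φ, hφ, hlc, -⟩ := hproj u hu
    gcongr ‖μ‖ ^ 2 + ?_
    refine mul_le_mul_of_nonneg_left ?_ (by positivity)
    -- A zero denominator is harmless: the quotient is then 0.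
    refine div_le_of_le_mul₀ (mul_nonneg measureReal_nonneg
      (sub_nonneg.2 measureReal_le_one)) (by positivity) ?_
    refine (sq_setIntegral_Ioi_id_le hφ hlc (hint u) (hmed u hu) ht).trans (le_of_eq ?_)
    ring
  refine ⟨fun u hu t => ?_, ?_⟩
  · rcases le_total 0 t with ht | ht
    · exact hnonneg u hu t ht
    · obtain ⟨φ, hφ, -, -⟩ := hproj u hu
      rw [← halfspaceFunctional_neg_neg hXm hXμ hφ.absolutelyContinuous t,
        ← halfspaceFunctional_neg_neg hXm hXμ hφ.absolutelyContinuous 0, neg_zero]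
      exact hnonneg (-u) (by rwa [norm_neg]) (-t) (by linarith)
  have : Nonempty (Fin d) := ⟨⟨0, hd⟩⟩
  have habs : ∀ u, ∫ ω, |inner ℝ (X ω - μ) u| ∂P =
      2 * ∫ x in Ioi 0, x ∂(P.map fun ω => inner ℝ (X ω - μ) u) := by
    intro u
    rw [← integral_map (φ := fun ω => inner ℝ (X ω - μ) u) (f := fun x : ℝ => |x|)
      (hZm u).aemeasurable (by fun_prop)]
    set ν := P.map fun ω => inner ℝ (X ω - μ) u
    have h1 := integral_add_compl (measurableSet_Ioi (a := (0 : ℝ))) (hint u)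
    have h2 := integral_add_compl (measurableSet_Ioi (a := (0 : ℝ))) (hint u).abs
    rw [hmean u] at h1
    rw [← h2, setIntegral_congr_fun (g := fun x : ℝ => x) measurableSet_Ioi
      (fun x hx => abs_of_pos hx), setIntegral_congr_fun (g := fun x : ℝ => -x)
      measurableSet_Ioi.compl (fun x hx => abs_of_nonpos (not_lt.1 hx)), integral_neg]
    linarith
  obtain ⟨e, he⟩ := exists_norm_eq (EuclideanSpace ℝ (Fin d)) zero_le_one
  -- The ratio is the same for every nonzero vector, so the choice of `e` is immaterial.
  set κ := (∫ ω, |inner ℝ (X ω - μ) e| ∂P) ^ 2 / inner ℝ e (Matrix.toEuclideanLin S e) with hκ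
  have hκpos : 0 < κ := by
    have := hprob e
    have h1 := setIntegral_Ioi_zero_id_pos (hint e) (hmed e he)
    have h2 := hpos e (hne he)
    rw [hκ, habs]
    positivity
  have hF0 : ∀ u, ‖u‖ = 1 → halfspaceFunctional P X u 0 = ‖μ‖ ^ 2 +
      κ * (‖Matrix.toEuclideanLin S u‖ ^ 2 / inner ℝ u (Matrix.toEuclideanLin S u)) := by
    intro u hu
    have h1 := sq_integral_abs_inner_mul
      (fun a ha => identDistrib_scatterReflection hXm hS hell ha) hL hpos (hne hu) (hne he)
    have h2 := hpos e (hne he)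
    have h3 := hpos u (hne hu)
    rw [hF u hu 0, hmed u hu]
    have h4 : (2 * ∫ x in Ioi 0, x ∂(P.map fun ω => inner ℝ (X ω - μ) u)) ^ 2 =
        κ * inner ℝ u (Matrix.toEuclideanLin S u) := by
      rw [← habs, hκ, div_mul_eq_mul_div, eq_div_iff h2.ne', h1]
    rw [show ∀ H : ℝ, H ^ 2 / (1 / 2 * (1 - 1 / 2)) = (2 * H) ^ 2 from fun H => by ring, h4]
    field_simp
  obtain ⟨lam, hlam, hmax⟩ := exists_isGreatest_eigenvalue_forall_maximizer_iff hL hpos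
  refine ⟨lam, hlam, fun u hu => ?_⟩
  rw [← hmax u hu]
  refine forall₂_congr fun v hv => ?_
  rw [hF0 u hu, hF0 v hv, add_le_add_iff_left, mul_le_mul_iff_right₀ hκpos]
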